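/- **Theorem (Asynchronous G-Lemma).** Let $M,\kappa,d$ be natural numbers and let $\|\cdot\|$ be the Euclidean norm of $\mathbb R^d$ and of $(\mathbb R^d)^\kappa$. *Network.* Let $a^{i,j}(t)\ge 0$ with $\sum_{j=1}^M a^{i,j}(t)=1$ and integers $0\le\tau^{i,j}(t)\le t$ be given ($1\le i,j\le M$, $t\in\mathbb N$). Write $(j,i)\in E(t)$ iff $a^{i,j}(t)>0$. Assume: (a) $\tau^{i,j}(t)=t$ whenever $a^{i,j}(t)=0$; $\tau^{i,i}(t)=t$; and there is an integer $B_1>0$ with $t-B_1<\tau^{i,j}(t)\le t$ for all $i,j,t$; (b) there is $\alpha>0$ with $a^{i,i}(t)\ge\alpha$ and $a^{i,j}(t)\in\{0\}\cup[\alpha,1]$ for all $i,j,t$; (c) the directed graph $(\{1,\dots,M\},\bigcup_{s\ge t}E(s))$ is strongly connected for every $t$; (d) at least one of the following holds: (d1) whenever $(i,j)\in E(t)$ for infinitely many $t$, there is an integer $B_2>0$ with $(i,j)\in E(t)\cup\dots\cup E(t+B_2-1)$ for all $t$; (d2) there is $B_3>0$ such that $(i,j)\in E(t)$ implies $(j,i)\in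 E(\tau)$ for some $\tau$ with $|t-\tau|<B_3$. For the iterations $w^i(t+1)=\sum_j a^{i,j}(t)w^j(\tau^{i,j}(t))+s^i(t)$, let $\phi^{i,j}(t,\tau)$, $-1\le\tau<t$, be the real coefficients, depending only on the network, such that $w^i(t)=\sum_j\phi^{i,j}(t,-1)w^j(0)+\sum_{\tau=0}^{t-1}\sum_j\phi^{i,j}(t,\tau)s^j(\tau)$ for all initial values and descent terms, and let $\phi^j(\tau)=\lim_{t\to\infty}\phi^{i,j}(t,\tau)$, a limit which does not depend on $i$. *Quantization.* Let $\mu$ be a probability measure on $\mathbb R^d$ with a bounded density with respect to the Lebesgue measure, whose support is equal to its closed convex hull $\mathcal G$, and assume that $\mathcal G$ is compact. For $w\in(\mathbb R^d)^\kappa$, let $W_\ell(w)=\{v\in\mathcal G:\|w_\ell-v\|<\|w_k-v\|\text{ for all }k\text{ with }w_k\ne w_\ell\}$ if $\ell=\min\{k:w_k=w_\ell\}$, and $W_\ell(w)=\emptyset$ otherwise. Set $H(z,w)=\big((w_\ell-z)\mathbf 1_{\{z\in W_\ell(w)\}}\big)_{1\le\ell\le\kappa}$ and $h(w)=\int_{\mathcal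 G}H(z,w)\,d\mu(z)$. *Algorithm.* Let $z^i_t$ ($1\le i\le M$, $t\ge1$) be independent random variables of law $\mu$ on a probability space, $\varepsilon^i_t\in(0,1)$ deterministic steps, $T^i\subset\mathbb N$ deterministic sets, and $w^i(0)\in(\mathbb R^d)^\kappa$ deterministic initial values. Let $w^i(t)$ be given by the above iterations with $s^i(t)=-\varepsilon^i_{t+1}H(z^i_{t+1},w^i(t))$ if $t\in T^i$ and $s^i(t)=0$ otherwise. Define the agreement vector and the steps $$w^\star(t)=\sum_j\phi^j(-1)w^j(0)+\sum_{\tau=0}^{t-1}\sum_j\phi^j(\tau)s^j(\tau),\qquad \varepsilon^\star_{t+1}=\sum_j\mathbf 1_{\{t\in T^j\}}\phi^j(t)\varepsilon^j_{t+1}\qquad(t\ge0),$$ and $$\Delta M^{(1)}_t=\sum_j\mathbf 1_{\{t\in T^j\}}\phi^j(t)\varepsilon^j_{t+1}\big(h(w^\star(t))-h(w^j(t))\big),\qquad \Delta M^{(2)}_t=\sum_j\mathbf 1_{\{t\in T^j\}}\phi^j(t)\varepsilon^j_{t+1}\big(h(w^j(t))-H(z^j_{t+1},w^j(t))\big).$$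 Suppose that 1. $\sum_{t\ge0}\varepsilon^\star_{t+1}=\infty$ and $\varepsilon^\star_t\to0$ as $t\to\infty$; 2. the sequences $(w^\star(t))_{t\ge0}$ and $(h(w^\star(t)))_{t\ge0}$ are bounded almost surely; 3. the series $\sum_{t\ge0}\Delta M^{(1)}_t$ and $\sum_{t\ge0}\Delta M^{(2)}_t$ converge almost surely in $(\mathbb R^d)^\kappa$; 4. $G:(\mathbb R^d)^\kappa\to[0,\infty)$ is a lower semicontinuous function with $\sum_{t\ge0}\varepsilon^\star_{t+1}G(w^\star(t))<\infty$ almost surely. Then there is a random connected component $\Xi$ of $\{G=0\}$, namely the connected component in $\{G=0\}$ of a random variable $\xi$ which lies almost surely in $\{G=0\}$, such that $$\operatorname{dist}(w^\star(t),\Xi)\xrightarrow[t\to\infty]{}0\quad\text{almost surely.}$$ -/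

import Mathlib

open MeasureTheory ProbabilityTheory Filter Topology

/-- `ℝ^d` with its Euclidean norm. -/
abbrev Pt (d : ℕ) : Type := EuclideanSpace ℝ (Fin d)

/-- The space `(ℝ^d)^κ` of quantizers, with its Euclidean norm. -/
abbrev Quantizer (κ d : ℕ) : Type := PiLp 2 (fun _ : Fin κ => Pt d)

/-! ### Distributed asynchronous iterations -/

/-- Combining coefficients `a i j t` and (deterministic) time instants `tau i j t` of a network of
`M` processors: agent `i` combines at time `t` the versions `w^j (tau i j t)`, with convex
weights. -/
structure AsyncNetwork (M : ℕ) where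
  a : Fin M → Fin M → ℕ → ℝ
  tau : Fin M → Fin M → ℕ → ℕ
  a_nonneg : ∀ i j t, 0 ≤ a i j t
  a_sum : ∀ i t, ∑ j, a i j t = 1
  tau_le : ∀ i j t, tau i j t ≤ t

namespace AsyncNetwork

variable {M : ℕ} (N : AsyncNetwork M)

/-- The iterations `w^i(t+1) = ∑ j, a^{i,j}(t) w^j(τ^{i,j}(t)) + s^i(t)`; the descent term of
agent `i` at time `t` may depend on its current version, `s^i(t) = s i t (w^i(t))`. -/
noncomputable def iterate {V : Type*} [AddCommGroup V] [Module ℝ V]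
    (w0 : Fin M → V) (s : Fin M → ℕ → V → V) : ℕ → Fin M → V
  | 0, i => w0 i
  | t + 1, i =>
      (∑ j, N.a i j t • iterate w0 s (N.tau i j t) j) + s i t (iterate w0 s t i)
  termination_by t => t
  decreasing_by
  · exact Nat.lt_succ_of_le (N.tau_le _ _ _)
  · exact Nat.lt_succ_self _

/-- The coefficient `φ^{i,j}(t, σ - 1)`: the value held by agent `i` at time `t` in the real-valued
iterations whose only nonzero input is a unit input of agent `j`, namely the initial value
`w^j(0) = 1` if `σ = 0`, and the descent term `s^j(σ - 1) = 1` if `σ ≥ 1`. -/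
noncomputable def coeff (i j : Fin M) (t σ : ℕ) : ℝ :=
  N.iterate (fun k => if k = j ∧ σ = 0 then (1 : ℝ) else 0)
    (fun k τ _ => if k = j ∧ σ = τ + 1 then (1 : ℝ) else 0) t i

theorem coeff_succ (i j : Fin M) (t σ : ℕ) :
    N.coeff i j (t + 1) σ = (∑ k, N.a i k t * N.coeff k j (N.tau i k t) σ) +
      if i = j ∧ σ = t + 1 then 1 else 0 := by
  rw [coeff, iterate]
  simp only [smul_eq_mul, coeff]

theorem coeff_eq_zero (j : Fin M) (σ : ℕ) : ∀ (t : ℕ) (i : Fin M), t < σ →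
    N.coeff i j t σ = 0 := by
  intro t
  induction t using Nat.strong_induction_on with
  | _ t ih =>
    intro i ht
    cases t with
    | zero => rw [coeff, iterate, if_neg (by omega)]
    | succ t =>
      rw [coeff_succ, if_neg (by omega), add_zero]
      refine Finset.sum_eq_zero fun k _ => ?_
      have := N.tau_le i k t
      rw [ih _ (by omega) k (by omega), mul_zero]

/-- The coefficients `coeff i j t σ` are those of the linear decomposition of the versions with
respect to the initial values and the descent terms. -/
theorem iterate_eq_sum_coeff {V : Type*} [AddCommGroup V] [Module ℝ V]
    (w0 : Fin M → V) (s : Fin M → ℕ → V) (t : ℕ) (i : Fin M) :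
    N.iterate w0 (fun k τ _ => s k τ) t i =
      (∑ j, N.coeff i j t 0 • w0 j) +
        ∑ τ ∈ Finset.range t, ∑ j, N.coeff i j t (τ + 1) • s j τ := by
  have key : ∀ (t : ℕ) (i : Fin M) (n : ℕ), t ≤ n → N.iterate w0 (fun k τ _ => s k τ) t i =
      (∑ j, N.coeff i j t 0 • w0 j) +
        ∑ τ ∈ Finset.range n, ∑ j, N.coeff i j t (τ + 1) • s j τ := by
    intro t
    induction t using Nat.strong_induction_on with
    | _ t ih =>
      intro i n hn
      cases t with
      | zero =>
        rw [iterate, Finset.sum_eq_zero (s := Finset.range n), add_zero]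
        · simp [coeff, iterate, ite_smul]
        · intro τ _
          exact Finset.sum_eq_zero fun j _ => by
            rw [N.coeff_eq_zero j _ 0 i (by omega), zero_smul]
      | succ t =>
        have h1 : ∀ k, N.iterate w0 (fun k τ _ => s k τ) (N.tau i k t) k =
            (∑ j, N.coeff k j (N.tau i k t) 0 • w0 j) + ∑ τ ∈ Finset.range n, ∑ j,
              N.coeff k j (N.tau i k t) (τ + 1) • s j τ := fun k => by
          have := N.tau_le i k t
          exact ih _ (by omega) k n (by omega)
        have h2 : ∑ τ ∈ Finset.range n, ∑ j,
            (if i = j ∧ τ + 1 = t + 1 then (1 : ℝ) else 0) • s j τ = s i t := by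
          rw [Finset.sum_eq_single t, Finset.sum_eq_single i]
          · simp
          · intro j _ hj
            simp [Ne.symm hj]
          · simp
          · intro τ _ hτ
            simp [hτ]
          · intro h
            exact absurd (Finset.mem_range.2 (by omega)) h
        rw [iterate]
        simp only [h1, coeff_succ, add_smul, Finset.sum_add_distrib, h2, smul_add, Finset.smul_sum,
          Finset.sum_smul, smul_smul]
        rw [← add_assoc]
        congr 1
        congr 1
        · rw [Finset.sum_comm]
          simp
        · rw [Finset.sum_comm]
          refine Finset.sum_congr rfl fun τ _ => Finset.sum_comm
  exact key t i t le_rfl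

open Classical in
/-- The limit `φ^j(σ - 1)` of `φ^{i,j}(t, σ - 1)` as `t → ∞`, common to all agents `i`
(by convention `0` if there is no such common limit). -/
noncomputable def limCoeff (j : Fin M) (σ : ℕ) : ℝ :=
  if h : ∃ l : ℝ, ∀ i, Tendsto (fun t => N.coeff i j t σ) atTop (𝓝 l) then h.choose else 0

/-- The agreement vector
`w⋆(t) = ∑ j, φ^j(-1) w^j(0) + ∑ τ < t, ∑ j, φ^j(τ) s^j(τ)`. -/
noncomputable def agreement {V : Type*} [AddCommGroup V] [Module ℝ V]
    (w0 : Fin M → V) (s : Fin M → ℕ → V) (t : ℕ) : V :=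
  (∑ j, N.limCoeff j 0 • w0 j) +
    ∑ τ ∈ Finset.range t, ∑ j, N.limCoeff j (τ + 1) • s j τ

/-- `(j, i)` is an edge of the communication graph at time `t`. -/
def Edge (t : ℕ) (j i : Fin M) : Prop := 0 < N.a i j t

/-- Bounded communication delays. -/
def BoundedDelays : Prop :=
  (∀ i j t, N.a i j t = 0 → N.tau i j t = t) ∧
  (∀ i t, N.tau i i t = t) ∧
  ∃ B₁ : ℕ, 0 < B₁ ∧ ∀ i j t, t < N.tau i j t + B₁ ∧ N.tau i j t ≤ t

/-- Convex combination and threshold. -/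
def ConvexThreshold : Prop :=
  ∃ α : ℝ, 0 < α ∧
    (∀ i t, α ≤ N.a i i t) ∧
    (∀ i j t, N.a i j t = 0 ∨ N.a i j t ∈ Set.Icc α 1) ∧
    (∀ i t, ∑ j, N.a i j t = 1)

/-- For every `t`, the union of the communication graphs at times `s ≥ t` is strongly
connected. -/
def GraphConnectivity : Prop :=
  ∀ (t : ℕ) (i j : Fin M), Relation.ReflTransGen (fun k l => ∃ s, t ≤ s ∧ N.Edge s k l) i j

/-- Bounded communication intervals. -/
def BoundedIntervals : Prop :=
  ∀ i j : Fin M, {t : ℕ | N.Edge t i j}.Infinite →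
    ∃ B₂ : ℕ, 0 < B₂ ∧ ∀ t : ℕ, ∃ r < B₂, N.Edge (t + r) i j

/-- Symmetry of the communications. -/
def Symmetry : Prop :=
  ∃ B₃ : ℕ, 0 < B₃ ∧ ∀ (i j : Fin M) (t : ℕ), N.Edge t i j →
    ∃ τ : ℕ, |(t : ℤ) - τ| < B₃ ∧ N.Edge τ j i

/-- The first set of assumptions on the network. -/
def AsY₁ : Prop :=
  N.BoundedDelays ∧ N.ConvexThreshold ∧ N.GraphConnectivity ∧ N.BoundedIntervals

/-- The second set of assumptions on the network. -/
def AsY₂ : Prop :=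
  N.BoundedDelays ∧ N.ConvexThreshold ∧ N.GraphConnectivity ∧ N.Symmetry

end AsyncNetwork

/-! ### Quantization -/

/-- The closed convex hull of the support of `μ`. -/
noncomputable def hullSupport {d : ℕ} (μ : Measure (Pt d)) : Set (Pt d) :=
  closedConvexHull ℝ μ.support

/-- `μ` has a bounded density with respect to the Lebesgue measure, its support is equal to its
closed convex hull, and the latter is compact. -/
def CompactSupportedDensity {d : ℕ} (μ : Measure (Pt d)) : Prop :=
  (∃ (f : Pt d → ENNReal) (K : NNReal), Measurable f ∧ (∀ x, f x ≤ K) ∧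
    μ = (volume : Measure (Pt d)).withDensity f) ∧
  μ.support = hullSupport μ ∧ IsCompact (hullSupport μ)

/-- The `ℓ`-th Voronoï cell `W_ℓ(w)` of the closed convex hull of the support of `μ`.  If several
components of `w` coincide with `w_ℓ`, only the one with the smallest index has a nonempty cell; if
the components of `w` are pairwise distinct, the second clause is void and `w k ≠ w ℓ` means
`k ≠ ℓ`. -/
def voronoiCell {κ d : ℕ} (μ : Measure (Pt d)) (w : Quantizer κ d) (ℓ : Fin κ) : Set (Pt d) :=
  {v | v ∈ hullSupport μ ∧ (∀ k, w k = w ℓ → ℓ ≤ k) ∧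
    ∀ k, w k ≠ w ℓ → ‖w ℓ - v‖ < ‖w k - v‖}

/-- `H(z, w) = ((w_ℓ - z) 1_{z ∈ W_ℓ(w)})_ℓ`. -/
noncomputable def gradObs {κ d : ℕ} (μ : Measure (Pt d)) (z : Pt d) (w : Quantizer κ d) :
    Quantizer κ d :=
  WithLp.toLp 2 fun ℓ => (voronoiCell μ w ℓ).indicator (fun x => w ℓ - x) z

/-- The average function `h(w) = ∫ H(z, w) dμ(z)`. -/
noncomputable def avgGrad {κ d : ℕ} (μ : Measure (Pt d)) (w : Quantizer κ d) : Quantizer κ d :=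
  ∫ z in hullSupport μ, gradObs μ z w ∂μ

/-! ### The distributed asynchronous learning vector quantization algorithm -/

/-- The deterministic parameters of the algorithm: the network, the set `T i` of the times at which
agent `i` performs a descent step, the `(0,1)`-valued steps `eps i t` and the initial versions. -/
structure DALVQ (M κ d : ℕ) where
  net : AsyncNetwork M
  T : Fin M → Set ℕ
  eps : Fin M → ℕ → ℝ
  eps_mem : ∀ i t, eps i t ∈ Set.Ioo (0 : ℝ) 1
  init : Fin M → Quantizer κ d

namespace DALVQ

variable {M κ d : ℕ} (A : DALVQ M κ d) (μ : Measure (Pt d))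

/-- `1_{t ∈ T^j} φ^j(t) ε^j_{t+1}`. -/
noncomputable def weight (j : Fin M) (t : ℕ) : ℝ :=
  (A.T j).indicator (fun t => A.net.limCoeff j (t + 1) * A.eps j (t + 1)) t

/-- `epsStar t` is `ε⋆_{t+1} = ∑ j, 1_{t ∈ T^j} φ^j(t) ε^j_{t+1}`. -/
noncomputable def epsStar (t : ℕ) : ℝ := ∑ j, A.weight j t

/-- The version `w^i(t)` of agent `i`, when `z i t` is the value of the observation `z^i_t`
(`t ≥ 1`). -/
noncomputable def version (z : Fin M → ℕ → Pt d) (i : Fin M) (t : ℕ) : Quantizer κ d :=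
  A.net.iterate A.init
    (fun i t w => (A.T i).indicator (fun t => -(A.eps i (t + 1) • gradObs μ (z i (t + 1)) w)) t)
    t i

/-- The descent term `s^i(t) = -ε^i_{t+1} H(z^i_{t+1}, w^i(t))` if `t ∈ T^i`, and `0`
otherwise. -/
noncomputable def descent (z : Fin M → ℕ → Pt d) (i : Fin M) (t : ℕ) : Quantizer κ d :=
  (A.T i).indicator
    (fun t => -(A.eps i (t + 1) • gradObs μ (z i (t + 1)) (A.version μ z i t))) t

/-- The agreement vector `w⋆(t)` of the algorithm. -/
noncomputable def wStar (z : Fin M → ℕ → Pt d) (t : ℕ) : Quantizer κ d :=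
  A.net.agreement A.init (A.descent μ z) t

/-- `ΔM^{(1)}_t = ∑ j, 1_{t ∈ T^j} φ^j(t) ε^j_{t+1} (h(w⋆(t)) - h(w^j(t)))`. -/
noncomputable def deltaM₁ (z : Fin M → ℕ → Pt d) (t : ℕ) : Quantizer κ d :=
  ∑ j, A.weight j t • (avgGrad μ (A.wStar μ z t) - avgGrad μ (A.version μ z j t))

/-- `ΔM^{(2)}_t = ∑ j, 1_{t ∈ T^j} φ^j(t) ε^j_{t+1} (h(w^j(t)) - H(z^j_{t+1}, w^j(t)))`. -/
noncomputable def deltaM₂ (z : Fin M → ℕ → Pt d) (t : ℕ) : Quantizer κ d :=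
  ∑ j, A.weight j t •
    (avgGrad μ (A.version μ z j t) - gradObs μ (z j (t + 1)) (A.version μ z j t))

end DALVQ

/-! ### Cluster points of sequences with vanishing increments -/

section ClusterPoints

variable {E : Type*}

/-! Telescoping shows that `w⋆` follows a descent scheme with direction `h(w⋆)`, steps `ε⋆` and
noise `ΔM⁽¹⁾ + ΔM⁽²⁾` (`DALVQ.wStar_succ`); the rest is deterministic, path by path. Every cluster
point is a zero of `G`. If `G x > 0`, then `G` is bounded below by a positive constant near `x`, so
the steps taken there have finite sum. Late enough, drift and noise are too small to push the path
out once it comes close to `x`. It then stays forever, and `∑ ε⋆ < ∞`, a contradiction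
(`eq_zero_of_mapClusterPt_of_summable`). The increments tend to zero and the path is bounded, so its
cluster set is connected (`isPreconnected_setOf_mapClusterPt`) and attracts the path. It therefore
lies in a single component of `{G = 0}`, that of any cluster point. It remains to choose this point
measurably in `ω`: `exists_measurable_mapClusterPt` does so by greedy nested balls. -/

theorem eventually_mem_thickening_mapClusterPt [PseudoMetricSpace E] [ProperSpace E] {w : ℕ → E}
    (hw : Bornology.IsBounded (Set.range w)) {δ : ℝ} (hδ : 0 < δ) :
    ∀ᶠ t in atTop, w t ∈ Metric.thickening δ {x | MapClusterPt x atTop w} := by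
  by_contra hcon
  rw [not_eventually] at hcon
  have hK : IsCompact (closure (Set.range w) \
      Metric.thickening δ {x | MapClusterPt x atTop w}) :=
    hw.isCompact_closure.diff Metric.isOpen_thickening
  obtain ⟨x, hx, hcl⟩ := hK.exists_mapClusterPt_of_frequently (f := w) (l := atTop)
    (hcon.mono fun t ht => ⟨subset_closure ⟨t, rfl⟩, ht⟩)
  exact hx.2 (Metric.self_subset_thickening hδ _ hcl)

/-- If the cluster set split into two separated closed pieces, the path would have to visit both
infinitely often, yet its vanishing increments eventually forbid crossing the gap. -/
theorem isPreconnected_setOf_mapClusterPt [PseudoMetricSpace E] [ProperSpace E] {w : ℕ → E}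
    (hw : Bornology.IsBounded (Set.range w))
    (hinc : Tendsto (fun t => dist (w (t + 1)) (w t)) atTop (𝓝 0)) :
    IsPreconnected {x | MapClusterPt x atTop w} := by
  set L := {x | MapClusterPt x atTop w} with hL
  have hLcl : IsClosed L := isClosed_setOfPred_clusterPt
  have hLsub : L ⊆ closure (Set.range w) := fun x hx => by
    rw [mem_closure_iff_nhds]
    intro s hs
    obtain ⟨t, ht⟩ := (mapClusterPt_iff_frequently.1 hx s hs).exists
    exact ⟨w t, ht, t, rfl⟩
  have hLc : IsCompact L := hw.isCompact_closure.of_isClosed_subset hLcl hLsub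
  rw [isPreconnected_iff_subset_of_disjoint_closed]
  intro u v hu hv huv hdisj
  have hd : Disjoint (L ∩ u) (L ∩ v) := Set.disjoint_left.2 fun x hx hx' => by
    have : x ∈ L ∩ (u ∩ v) := ⟨hx.1, hx.2, hx'.2⟩
    rw [hdisj] at this
    exact this
  obtain ⟨δ, hδ, hth⟩ := hd.exists_thickenings (hLc.inter_right hu) (hLcl.inter hv)
  -- Halving leaves room for one increment: a step shorter than `δ / 2` from a `δ / 2`-thickening
  -- ends in the disjoint `δ`-thickening of the same piece.
  have hδ2 : 0 < δ / 2 := by positivity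
  have hev : ∀ᶠ t in atTop, w t ∈ Metric.thickening (δ / 2) (L ∩ u) ∨
      w t ∈ Metric.thickening (δ / 2) (L ∩ v) := by
    filter_upwards [eventually_mem_thickening_mapClusterPt hw hδ2] with t ht
    have hLuv : L = (L ∩ u) ∪ (L ∩ v) := by
      rw [← Set.inter_union_distrib_left, Set.inter_eq_left.2 huv]
    rw [← hL, hLuv, Metric.thickening_union] at ht
    exact ht
  obtain ⟨N, hN⟩ := eventually_atTop.1 (hev.and (hinc.eventually (gt_mem_nhds hδ2)))
  have hmono : ∀ A : Set E, Metric.thickening (δ / 2) A ⊆ Metric.thickening δ A := fun A =>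
    Metric.thickening_mono (by linarith) A
  have step : ∀ A B : Set E, Disjoint (Metric.thickening δ A) (Metric.thickening δ B) →
      (∀ t, N ≤ t → w t ∈ Metric.thickening (δ / 2) A ∨ w t ∈ Metric.thickening (δ / 2) B) →
      w N ∈ Metric.thickening (δ / 2) A → B ⊆ L → B = ∅ := by
    intro A B hAB hor hwN hBL
    have hstay : ∀ t, N ≤ t → w t ∈ Metric.thickening (δ / 2) A := by
      intro t ht
      induction t, ht using Nat.le_induction with
      | base => exact hwN
      | succ t ht ih =>
        refine (hor (t + 1) (by omega)).resolve_right fun hB => ?_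
        obtain ⟨a, ha, hda⟩ := Metric.mem_thickening_iff.1 ih
        have hA : w (t + 1) ∈ Metric.thickening δ A :=
          Metric.mem_thickening_iff.2 ⟨a, ha, by
            have := (hN t ht).2
            linarith [dist_triangle (w (t + 1)) (w t) a]⟩
        exact Set.disjoint_left.1 hAB hA (hmono B hB)
    refine Set.eq_empty_of_forall_notMem fun b hb => ?_
    have hfr := mapClusterPt_iff_frequently.1 (hBL hb) _
      (Metric.isOpen_thickening.mem_nhds (Metric.self_subset_thickening hδ B hb))
    obtain ⟨t, ht, htN⟩ := (hfr.and_eventually (eventually_ge_atTop N)).exists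
    exact Set.disjoint_left.1 hAB (hmono A (hstay t htN)) ht
  rcases (hN N le_rfl).1 with h | h
  · left
    have := step _ _ hth (fun t ht => (hN t ht).1) h Set.inter_subset_left
    intro x hx
    refine (huv hx).resolve_right fun hxv => ?_
    exact (Set.eq_empty_iff_forall_notMem.1 this x) ⟨hx, hxv⟩
  · right
    have := step _ _ hth.symm (fun t ht => (hN t ht).1.symm) h Set.inter_subset_left
    intro x hx
    refine (huv hx).resolve_left fun hxu => ?_
    exact (Set.eq_empty_iff_forall_notMem.1 this x) ⟨hx, hxu⟩

theorem Filter.Tendsto.sum_range_term [AddCommGroup E] [TopologicalSpace E]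
    [IsTopologicalAddGroup E] {u : ℕ → E} {S : E}
    (h : Tendsto (fun n => ∑ t ∈ Finset.range n, u t) atTop (𝓝 S)) :
    Tendsto u atTop (𝓝 0) := by
  have := ((tendsto_add_atTop_iff_nat 1).2 h).sub h
  simpa [Finset.sum_range_succ] using this

/-- A perturbed descent scheme `w (t + 1) = w t - ε t • v t + δ t` with `∑ ε = ∞`, bounded `v`
and convergent `∑ δ` only clusters at zeros of a lower semicontinuous `G ≥ 0` such that
`∑ ε G(w) < ∞`. -/
theorem eq_zero_of_mapClusterPt_of_summable [NormedAddCommGroup E] [NormedSpace ℝ E]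
    {w v δ : ℕ → E} {ε : ℕ → ℝ} (hε : ∀ t, 0 ≤ ε t)
    (hsum : Tendsto (fun n => ∑ t ∈ Finset.range n, ε t) atTop atTop)
    (hrec : ∀ t, w (t + 1) = w t - ε t • v t + δ t) {C : ℝ} (hv : ∀ t, ‖v t‖ ≤ C)
    {S : E} (hδ : Tendsto (fun n => ∑ t ∈ Finset.range n, δ t) atTop (𝓝 S))
    {G : E → ℝ} (hG : LowerSemicontinuous G) (hG0 : ∀ x, 0 ≤ G x)
    (hGs : Summable fun t => ε t * G (w t)) {x : E} (hx : MapClusterPt x atTop w) : G x = 0 := by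
  by_contra hne
  have hpos : 0 < G x := lt_of_le_of_ne (hG0 x) (Ne.symm hne)
  obtain ⟨r, hr, hball⟩ := Metric.eventually_nhds_iff_ball.1 (hG x (G x / 2) (by linarith))
  have hC : 0 ≤ C := (norm_nonneg _).trans (hv 0)
  -- `e` keeps only the steps taken inside the ball, where `G > G x / 2`; hence `e ≤ (2 / G x) * ε *
  -- G(w)`.
  set e : ℕ → ℝ := {t | w t ∈ Metric.ball x r}.indicator ε with he
  have he0 : ∀ t, 0 ≤ e t := Set.indicator_nonneg fun t _ => hε t
  have hes : Summable e := by
    refine Summable.of_nonneg_of_le he0 (fun t => ?_) (hGs.mul_left (2 / G x))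
    by_cases ht : w t ∈ Metric.ball x r
    · have h1 : e t = ε t := Set.indicator_of_mem (s := {t | w t ∈ Metric.ball x r}) ht ε
      have h2 := (hball _ ht).le
      have h3 : 1 ≤ 2 / G x * G (w t) := by
        rw [div_mul_eq_mul_div, le_div_iff₀ hpos]
        linarith
      rw [h1]
      nlinarith [mul_le_mul_of_nonneg_left h3 (hε t)]
    · have h1 : e t = 0 := Set.indicator_of_notMem (s := {t | w t ∈ Metric.ball x r}) ht ε
      rw [h1]
      exact mul_nonneg (by positivity) (mul_nonneg (hε t) (hG0 _))
  have hr4 : 0 < r / 4 := by positivity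
  have hCe : CauchySeq fun n => ∑ t ∈ Finset.range n, C * e t :=
    (hes.mul_left C).hasSum.tendsto_sum_nat.cauchySeq
  obtain ⟨N₁, hN₁⟩ := Metric.cauchySeq_iff.1 hCe _ hr4
  obtain ⟨N₂, hN₂⟩ := Metric.cauchySeq_iff.1 hδ.cauchySeq _ hr4
  obtain ⟨m, hmx, hm⟩ := ((mapClusterPt_iff_frequently.1 hx _
    (Metric.ball_mem_nhds x (half_pos hr))).and_eventually
      (eventually_ge_atTop (max N₁ N₂))).exists
  have hm₁ : N₁ ≤ m := (le_max_left _ _).trans hm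
  have hm₂ : N₂ ≤ m := (le_max_right _ _).trans hm
  -- As long as the path has not left the ball, its displacement minus the noise is pure drift,
  -- controlled by `C * e`.
  have hw : ∀ n, m ≤ n → (∀ k, m ≤ k → k < n → w k ∈ Metric.ball x r) →
      ‖w n - w m - (∑ t ∈ Finset.range n, δ t - ∑ t ∈ Finset.range m, δ t)‖ ≤
        ∑ t ∈ Finset.range n, C * e t - ∑ t ∈ Finset.range m, C * e t := by
    intro n hn
    induction n, hn using Nat.le_induction with
    | base => simp
    | succ n hn ih =>
      intro hk
      have h1 := ih fun k h h' => hk k h (by omega)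
      have h2 : e n = ε n :=
        Set.indicator_of_mem (s := {t | w t ∈ Metric.ball x r}) (hk n hn (by omega)) ε
      have h3 : ‖ε n • v n‖ ≤ C * e n := by
        rw [norm_smul, Real.norm_of_nonneg (hε n), h2, mul_comm]
        exact mul_le_mul_of_nonneg_right (hv n) (hε n)
      rw [Finset.sum_range_succ, Finset.sum_range_succ, hrec]
      have h4 : w n - ε n • v n + δ n - w m -
          (∑ t ∈ Finset.range n, δ t + δ n - ∑ t ∈ Finset.range m, δ t) =
          (w n - w m - (∑ t ∈ Finset.range n, δ t - ∑ t ∈ Finset.range m, δ t)) -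
            ε n • v n := by abel
      rw [h4]
      linarith [norm_sub_le
        (w n - w m - (∑ t ∈ Finset.range n, δ t - ∑ t ∈ Finset.range m, δ t)) (ε n • v n)]
  -- Budget: the path is within `r / 2` of `x` at time `m`; afterwards drift and noise each cost
  -- less than `r / 4`.
  have hstay : ∀ n, m ≤ n → w n ∈ Metric.ball x r := by
    intro n
    induction n using Nat.strong_induction_on with
    | _ n ih =>
      intro hn
      have h1 := hw n hn fun k hk hk' => ih k hk' hk
      have h2 := hN₁ n (hm₁.trans hn) m hm₁
      have h3 := hN₂ n (hm₂.trans hn) m hm₂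
      rw [Real.dist_eq] at h2
      rw [dist_eq_norm] at h3
      have h4 := norm_le_norm_sub_add (w n - w m)
        (∑ t ∈ Finset.range n, δ t - ∑ t ∈ Finset.range m, δ t)
      have h5 : dist (w n) (w m) < r / 2 := by
        rw [dist_eq_norm]
        linarith [le_abs_self
          (∑ t ∈ Finset.range n, C * e t - ∑ t ∈ Finset.range m, C * e t)]
      rw [Metric.mem_ball] at hmx ⊢
      linarith [dist_triangle (w n) (w m) x]
  have hεs : Summable ε := by
    refine (summable_nat_add_iff m).1 (((summable_nat_add_iff m).2 hes).congr fun t => ?_)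
    exact (Set.indicator_of_mem (s := {t | w t ∈ Metric.ball x r}) (hstay (t + m) (by omega)) ε)
  exact not_tendsto_atTop_of_tendsto_nhds hεs.hasSum.tendsto_sum_nat hsum

/-- Under the assumptions of `eq_zero_of_mapClusterPt_of_summable`, a bounded scheme whose steps
tend to `0` converges to the connected component of any of its cluster points in `{G = 0}`. -/
theorem tendsto_infDist_connectedComponentIn [NormedAddCommGroup E] [NormedSpace ℝ E]
    [ProperSpace E] {w v δ : ℕ → E} {ε : ℕ → ℝ} (hε : ∀ t, 0 ≤ ε t)
    (hsum : Tendsto (fun n => ∑ t ∈ Finset.range n, ε t) atTop atTop)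
    (hε0 : Tendsto ε atTop (𝓝 0)) (hw : Bornology.IsBounded (Set.range w))
    (hrec : ∀ t, w (t + 1) = w t - ε t • v t + δ t) {C : ℝ} (hv : ∀ t, ‖v t‖ ≤ C)
    {S : E} (hδ : Tendsto (fun n => ∑ t ∈ Finset.range n, δ t) atTop (𝓝 S))
    {G : E → ℝ} (hG : LowerSemicontinuous G) (hG0 : ∀ x, 0 ≤ G x)
    (hGs : Summable fun t => ε t * G (w t)) {x : E} (hx : MapClusterPt x atTop w) :
    Tendsto (fun t => Metric.infDist (w t) (connectedComponentIn {x | G x = 0} x))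
      atTop (𝓝 0) := by
  have hinc : Tendsto (fun t => dist (w (t + 1)) (w t)) atTop (𝓝 0) := by
    have h1 : Tendsto (fun t => ε t * C + ‖δ t‖) atTop (𝓝 0) := by
      simpa using (hε0.mul_const C).add hδ.sum_range_term.norm
    refine squeeze_zero (fun _ => dist_nonneg) (fun t => ?_) h1
    have h2 : w (t + 1) - w t = δ t - ε t • v t := by rw [hrec]; abel
    rw [dist_eq_norm, h2]
    refine (norm_sub_le _ _).trans ?_
    rw [norm_smul, Real.norm_of_nonneg (hε t), add_comm]
    gcongr
    · exact hε t
    · exact hv t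
  have hsub : {x | MapClusterPt x atTop w} ⊆ connectedComponentIn {x | G x = 0} x :=
    (isPreconnected_setOf_mapClusterPt hw hinc).subset_connectedComponentIn hx fun y hy =>
      eq_zero_of_mapClusterPt_of_summable hε hsum hrec hv hδ hG hG0 hGs hy
  rw [Metric.tendsto_atTop]
  intro η hη
  obtain ⟨N, hN⟩ := eventually_atTop.1 (eventually_mem_thickening_mapClusterPt hw hη)
  refine ⟨N, fun t ht => ?_⟩
  obtain ⟨y, hy, hd⟩ := Metric.mem_thickening_iff.1 (hN t ht)
  rw [Real.dist_eq, sub_zero, abs_of_nonneg Metric.infDist_nonneg]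
  exact (Metric.infDist_le_dist_of_mem (hsub hy)).trans_lt hd

end ClusterPoints

/-! ### Measurable selection of a cluster point -/

section Selection

variable {E : Type*} [PseudoMetricSpace E]

/-- The nested intersection of balls of radii `1, 1/2, 1/4, …` centred at the points of `q` whose
indices are listed, from right to left. -/
def nestedBalls (q : ℕ → E) : List ℕ → Set E
  | [] => Set.univ
  | n :: l => nestedBalls q l ∩ Metric.ball (q n) ((1 / 2) ^ l.length)

/-- Greedy choice of indices such that `w` is frequently in the corresponding nested balls. -/
noncomputable def greedyIndices (q : ℕ → E) (w : ℕ → E) : ℕ → List ℕ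
  | 0 => []
  | k + 1 => sInf {n | ∃ᶠ t in atTop, w t ∈ nestedBalls q (n :: greedyIndices q w k)} ::
      greedyIndices q w k

theorem length_greedyIndices (q w : ℕ → E) (k : ℕ) : (greedyIndices q w k).length = k := by
  induction k with
  | zero => rfl
  | succ k ih => rw [greedyIndices, List.length_cons, ih]

/-- The center of the last ball in the greedy choice. -/
noncomputable def greedyCenter (q : ℕ → E) (w : ℕ → E) (k : ℕ) : E :=
  q ((greedyIndices q w (k + 1)).headI)

theorem isOpen_nestedBalls (q : ℕ → E) (l : List ℕ) : IsOpen (nestedBalls q l) := by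
  induction l with
  | nil => exact isOpen_univ
  | cons n l ih => exact ih.inter Metric.isOpen_ball

/-- A bounded path is covered by finitely many balls of the next radius, so one of them must be
visited infinitely often within the current intersection; thus the `sInf` in the greedy choice is
never taken over the empty set. -/
theorem frequently_mem_nestedBalls [ProperSpace E] {q w : ℕ → E} (hq : DenseRange q)
    (hw : Bornology.IsBounded (Set.range w)) (k : ℕ) :
    ∃ᶠ t in atTop, w t ∈ nestedBalls q (greedyIndices q w k) := by
  induction k with
  | zero => exact Frequently.of_forall fun t => Set.mem_univ _
  | succ k ih =>
    refine Nat.sInf_mem (s := {n | ∃ᶠ t in atTop,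
      w t ∈ nestedBalls q (n :: greedyIndices q w k)}) ?_
    by_contra hemp
    rw [Set.not_nonempty_iff_eq_empty, Set.eq_empty_iff_forall_notMem] at hemp
    set ρ : ℝ := (1 / 2) ^ (greedyIndices q w k).length
    have hρ : 0 < ρ := by positivity
    obtain ⟨F, hF⟩ := hw.isCompact_closure.elim_finite_subcover (fun n => Metric.ball (q n) ρ)
      (fun n => Metric.isOpen_ball) fun x _ => by
        obtain ⟨n, hn⟩ := hq.exists_dist_lt x hρ
        exact Set.mem_iUnion.2 ⟨n, hn⟩
    have hev : ∀ᶠ t in atTop, ∀ n ∈ F, w t ∉ nestedBalls q (n :: greedyIndices q w k) :=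
      (eventually_all_finset F).2 fun n _ => not_frequently.1 (hemp n)
    obtain ⟨t, ht, ht'⟩ := (ih.and_eventually hev).exists
    obtain ⟨n, hn, hb⟩ := Set.mem_iUnion₂.1 (hF (subset_closure ⟨t, rfl⟩))
    exact ht' n hn ⟨ht, hb⟩

theorem frequently_mem_ball_greedyCenter [ProperSpace E] {q w : ℕ → E} (hq : DenseRange q)
    (hw : Bornology.IsBounded (Set.range w)) (k : ℕ) :
    ∃ᶠ t in atTop, w t ∈ Metric.ball (greedyCenter q w k) ((1 / 2) ^ k) := by
  refine (frequently_mem_nestedBalls hq hw (k + 1)).mono fun t ht => ?_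
  have := ht.2
  rwa [length_greedyIndices] at this

theorem exists_tendsto_greedyCenter [ProperSpace E] {q w : ℕ → E} (hq : DenseRange q)
    (hw : Bornology.IsBounded (Set.range w)) : ∃ x, Tendsto (greedyCenter q w) atTop (𝓝 x) := by
  -- Consecutive balls share a point of the path, so their centers are less than `2 * (1 / 2) ^ k`
  -- apart.
  refine cauchySeq_tendsto_of_complete (cauchySeq_of_le_geometric (1 / 2) 2 (by norm_num)
    fun k => ?_)
  obtain ⟨t, ht⟩ := (frequently_mem_nestedBalls hq hw (k + 2)).exists
  have h1 := ht.2
  have h2 := ht.1.2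
  rw [length_greedyIndices, Metric.mem_ball] at h1 h2
  have h3 := dist_triangle_left (greedyCenter q w k) (greedyCenter q w (k + 1)) (w t)
  have h4 : ((1 : ℝ) / 2) ^ (k + 1) ≤ (1 / 2) ^ k :=
    pow_le_pow_of_le_one (by norm_num) (by norm_num) (by omega)
  have h5 : dist (w t) (greedyCenter q w k) < (1 / 2) ^ k := h2
  have h6 : dist (w t) (greedyCenter q w (k + 1)) < (1 / 2) ^ (k + 1) := h1
  linarith

theorem mapClusterPt_of_tendsto_greedyCenter [ProperSpace E] {q w : ℕ → E} (hq : DenseRange q)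
    (hw : Bornology.IsBounded (Set.range w)) {x : E}
    (hx : Tendsto (greedyCenter q w) atTop (𝓝 x)) : MapClusterPt x atTop w := by
  rw [Metric.nhds_basis_ball.mapClusterPt_iff_frequently]
  intro η hη
  have h1 : Tendsto (fun k => ((1 : ℝ) / 2) ^ k) atTop (𝓝 0) :=
    tendsto_pow_atTop_nhds_zero_of_lt_one (by norm_num) (by norm_num)
  obtain ⟨k, hk, hk'⟩ := ((h1.eventually (gt_mem_nhds (half_pos hη))).and
    (hx.eventually (Metric.ball_mem_nhds x (half_pos hη)))).exists
  refine (frequently_mem_ball_greedyCenter hq hw k).mono fun t ht => ?_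
  rw [Metric.mem_ball] at ht ⊢
  linarith [dist_triangle (w t) (greedyCenter q w k) x]

theorem measurable_nat_sInf {Ω : Type*} [MeasurableSpace Ω] {p : Ω → ℕ → Prop}
    (hp : ∀ n, MeasurableSet {ω | p ω n}) : Measurable fun ω => sInf {n | p ω n} := by
  refine measurable_to_countable' fun n => ?_
  -- The second set accounts for the default `sInf ∅ = 0`.
  have h : (fun ω => sInf {n | p ω n}) ⁻¹' {n} =
      ({ω | p ω n} ∩ ⋂ m, ⋂ (_ : m < n), {ω | p ω m}ᶜ) ∪
        ({_ω | n = 0} ∩ ⋂ m, {ω | p ω m}ᶜ) := by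
    ext ω
    simp only [Set.mem_preimage, Set.mem_singleton_iff, Set.mem_union, Set.mem_inter_iff,
      Set.mem_iInter, Set.mem_compl_iff, Set.mem_ofPred_eq]
    constructor
    · rintro rfl
      by_cases hne : {n | p ω n}.Nonempty
      · exact Or.inl ⟨Nat.sInf_mem hne, fun m hm => Nat.notMem_of_lt_sInf hm⟩
      · have hemp := Set.not_nonempty_iff_eq_empty.1 hne
        refine Or.inr ⟨by rw [hemp, Nat.sInf_empty], fun m hm => hne ⟨m, hm⟩⟩
    · rintro (⟨h1, h2⟩ | ⟨rfl, h2⟩)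
      · refine le_antisymm (Nat.sInf_le h1) (not_lt.1 fun hlt => h2 _ hlt ?_)
        exact Nat.sInf_mem (s := {n | p ω n}) ⟨n, h1⟩
      · rw [Set.eq_empty_of_forall_notMem (s := {n | p ω n}) h2, Nat.sInf_empty]
  rw [h]
  exact ((hp n).inter (MeasurableSet.iInter fun m => MeasurableSet.iInter fun _ =>
    (hp m).compl)).union ((MeasurableSet.const _).inter (MeasurableSet.iInter fun m =>
      (hp m).compl))

theorem measurableSet_frequently_mem {Ω E : Type*} [MeasurableSpace Ω] [MeasurableSpace E]
    {f : ℕ → Ω → E} (hf : ∀ t, Measurable (f t)) {s : Set E} (hs : MeasurableSet s) :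
    MeasurableSet {ω | ∃ᶠ t in atTop, f t ω ∈ s} := by
  simp only [frequently_atTop]
  measurability

variable {Ω : Type*} [MeasurableSpace Ω] [MeasurableSpace E] [BorelSpace E]

/-- Once the earlier indices are fixed to a given list, the next one is the `sInf` of a
deterministic family of measurable conditions. -/
theorem measurableSet_greedyIndices_eq (q : ℕ → E) {f : ℕ → Ω → E}
    (hf : ∀ t, Measurable (f t)) (k : ℕ) (l : List ℕ) :
    MeasurableSet {ω | greedyIndices q (fun t => f t ω) k = l} := by
  induction k generalizing l with
  | zero => exact MeasurableSet.const ([] = l)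
  | succ k ih =>
    cases l with
    | nil =>
      convert MeasurableSet.empty (α := Ω) using 1
      ext ω
      simp [greedyIndices]
    | cons n l =>
      have hmeas : Measurable fun ω => sInf {n | ∃ᶠ t in atTop, f t ω ∈ nestedBalls q (n :: l)} :=
        measurable_nat_sInf fun n =>
          measurableSet_frequently_mem hf (isOpen_nestedBalls q _).measurableSet
      have : {ω | greedyIndices q (fun t => f t ω) (k + 1) = n :: l} =
          {ω | greedyIndices q (fun t => f t ω) k = l} ∩
            {ω | sInf {n | ∃ᶠ t in atTop, f t ω ∈ nestedBalls q (n :: l)} = n} := by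
        ext ω
        simp only [greedyIndices, List.cons.injEq, Set.mem_ofPred_eq, Set.mem_inter_iff]
        constructor
        · rintro ⟨h1, rfl⟩
          exact ⟨rfl, h1⟩
        · rintro ⟨rfl, h1⟩
          exact ⟨h1, rfl⟩
      rw [this]
      exact (ih l).inter (hmeas (measurableSet_singleton n))

theorem measurable_greedyCenter (q : ℕ → E) {f : ℕ → Ω → E} (hf : ∀ t, Measurable (f t)) (k : ℕ) :
    Measurable fun ω => greedyCenter q (fun t => f t ω) k := by
  -- Lists of naturals are countable, so measurable fibres suffice even for the discrete σ-algebra.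
  have h : Measurable[_, ⊤] fun ω => greedyIndices q (fun t => f t ω) (k + 1) :=
    @measurable_to_countable' _ _ ⊤ _ _ _ fun l => measurableSet_greedyIndices_eq q hf (k + 1) l
  exact (@measurable_from_top _ _ _ fun l : List ℕ => q l.headI).comp h

/-- An almost surely bounded random sequence has a measurable random cluster point. -/
theorem exists_measurable_mapClusterPt [ProperSpace E] [Nonempty E]
    {P : Measure Ω} {f : ℕ → Ω → E} (hf : ∀ t, Measurable (f t))
    (hb : ∀ᵐ ω ∂P, Bornology.IsBounded (Set.range fun t => f t ω)) :
    ∃ ξ : Ω → E, Measurable ξ ∧ ∀ᵐ ω ∂P, MapClusterPt (ξ ω) atTop fun t => f t ω := by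
  have hq := TopologicalSpace.denseRange_denseSeq E
  obtain ⟨ξ, hξ, hlim⟩ := measurable_limit_of_tendsto_metrizable_ae (μ := P) (L := atTop)
    (fun k => (measurable_greedyCenter (TopologicalSpace.denseSeq E) hf k).aemeasurable)
    (hb.mono fun ω hω => exists_tendsto_greedyCenter hq hω)
  refine ⟨ξ, hξ, ?_⟩
  filter_upwards [hb, hlim] with ω h1 h2
  exact mapClusterPt_of_tendsto_greedyCenter hq h1 h2

end Selection

/-! ### Measurability of the algorithm -/

theorem measurable_gradObs {κ d : ℕ} (μ : Measure (Pt d)) :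
    Measurable fun p : Pt d × Quantizer κ d => gradObs μ p.1 p.2 := by
  have hcoord : ∀ ℓ : Fin κ, Measurable fun p : Pt d × Quantizer κ d => p.2 ℓ := fun ℓ =>
    ((PiLp.continuous_apply 2 (fun _ : Fin κ => Pt d) ℓ).comp continuous_snd).measurable
  refine (WithLp.measurable_toLp 2 _).comp (measurable_pi_lambda _ fun ℓ => ?_)
  have hcell : MeasurableSet {p : Pt d × Quantizer κ d | p.1 ∈ voronoiCell μ p.2 ℓ} := by
    have heq : ∀ k, MeasurableSet {p : Pt d × Quantizer κ d | p.2 k = p.2 ℓ} := fun k =>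
      measurableSet_eq_fun (hcoord k) (hcoord ℓ)
    have h1 : MeasurableSet {p : Pt d × Quantizer κ d | p.1 ∈ hullSupport μ} :=
      measurable_fst isClosed_closedConvexHull.measurableSet
    have h2 : MeasurableSet {p : Pt d × Quantizer κ d | ∀ k, p.2 k = p.2 ℓ → ℓ ≤ k} := by
      rw [Set.ofPred_forall]
      exact MeasurableSet.iInter fun k => (heq k).imp (MeasurableSet.const _)
    have h3 : MeasurableSet {p : Pt d × Quantizer κ d |
        ∀ k, p.2 k ≠ p.2 ℓ → ‖p.2 ℓ - p.1‖ < ‖p.2 k - p.1‖} := by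
      rw [Set.ofPred_forall]
      refine MeasurableSet.iInter fun k => (heq k).compl.imp ?_
      exact measurableSet_lt ((hcoord ℓ).sub measurable_fst).norm
        ((hcoord k).sub measurable_fst).norm
    exact h1.inter (h2.inter h3)
  exact ((hcoord ℓ).sub measurable_fst).indicator hcell

/-! ### Sign of the weights and recursion of the agreement vector -/

theorem AsyncNetwork.limCoeff_nonneg {M : ℕ} (N : AsyncNetwork M) (j : Fin M) (σ : ℕ) :
    0 ≤ N.limCoeff j σ := by
  have hc : ∀ (t : ℕ) (i : Fin M), 0 ≤ N.coeff i j t σ := by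
    intro t
    induction t using Nat.strong_induction_on with
    | _ t ih =>
      intro i
      cases t with
      | zero =>
        rw [coeff, iterate]
        positivity
      | succ t =>
        rw [coeff_succ]
        refine add_nonneg (Finset.sum_nonneg fun k _ => mul_nonneg (N.a_nonneg i k t)
          (ih _ (Nat.lt_succ_of_le (N.tau_le i k t)) k)) ?_
        positivity
  rw [limCoeff]
  split_ifs with h
  · exact ge_of_tendsto' (h.choose_spec j) fun t => hc t j
  -- Without a common limit, `limCoeff` is `0` by convention.
  · exact le_rfl

theorem AsyncNetwork.agreement_succ {M : ℕ} (N : AsyncNetwork M) {V : Type*} [AddCommGroup V]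
    [Module ℝ V] (w0 : Fin M → V) (s : Fin M → ℕ → V) (t : ℕ) :
    N.agreement w0 s (t + 1) = N.agreement w0 s t + ∑ j, N.limCoeff j (t + 1) • s j t := by
  rw [agreement, agreement, Finset.sum_range_succ, add_assoc]

namespace DALVQ

variable {M κ d : ℕ} (A : DALVQ M κ d) (μ : Measure (Pt d))

theorem weight_nonneg (j : Fin M) (t : ℕ) : 0 ≤ A.weight j t :=
  Set.indicator_nonneg (fun t _ => mul_nonneg (A.net.limCoeff_nonneg j (t + 1))
    (A.eps_mem j (t + 1)).1.le) t

theorem epsStar_nonneg (t : ℕ) : 0 ≤ A.epsStar t :=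
  Finset.sum_nonneg fun j _ => A.weight_nonneg j t

theorem limCoeff_smul_descent (z : Fin M → ℕ → Pt d) (j : Fin M) (t : ℕ) :
    A.net.limCoeff j (t + 1) • A.descent μ z j t =
      -(A.weight j t • gradObs μ (z j (t + 1)) (A.version μ z j t)) := by
  by_cases ht : t ∈ A.T j
  · simp only [descent, weight, Set.indicator_of_mem ht, smul_neg, smul_smul]
  · simp only [descent, weight, Set.indicator_of_notMem ht, smul_zero, zero_smul, neg_zero]

/-- The agreement vector follows a perturbed gradient descent. -/
theorem wStar_succ (z : Fin M → ℕ → Pt d) (t : ℕ) :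
    A.wStar μ z (t + 1) = A.wStar μ z t - A.epsStar t • avgGrad μ (A.wStar μ z t) +
      (A.deltaM₁ μ z t + A.deltaM₂ μ z t) := by
  rw [wStar, AsyncNetwork.agreement_succ, ← wStar, sub_add, sub_eq_add_neg, add_right_inj,
    epsStar, deltaM₁, deltaM₂, Finset.sum_smul, ← Finset.sum_add_distrib,
    ← Finset.sum_sub_distrib, ← Finset.sum_neg_distrib]
  refine Finset.sum_congr rfl fun j _ => ?_
  rw [limCoeff_smul_descent, smul_sub, smul_sub]
  abel

/-! ### Measurability of the versions and of the agreement vector -/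

variable {Ω : Type*} [MeasurableSpace Ω] {z : Fin M → ℕ → Ω → Pt d}

theorem measurable_indicator_gradObs (hz : ∀ i t, Measurable (z i (t + 1))) (i : Fin M) (t : ℕ)
    {w : Ω → Quantizer κ d} (hw : Measurable w) :
    Measurable fun ω => (A.T i).indicator
      (fun t => -(A.eps i (t + 1) • gradObs μ (z i (t + 1) ω) (w ω))) t := by
  by_cases ht : t ∈ A.T i
  · simp only [Set.indicator_of_mem ht]
    exact (((measurable_gradObs μ).comp ((hz i t).prodMk hw)).const_smul (A.eps i (t + 1))).neg
  · simp only [Set.indicator_of_notMem ht]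
    exact measurable_const

theorem measurable_version (hz : ∀ i t, Measurable (z i (t + 1))) (t : ℕ) (i : Fin M) :
    Measurable fun ω => A.version μ (fun i t => z i t ω) i t := by
  induction t using Nat.strong_induction_on generalizing i with
  | _ t ih =>
    cases t with
    | zero =>
      simp only [version, AsyncNetwork.iterate]
      exact measurable_const
    | succ t =>
      -- The version inside the indicator is frozen at time `t`, so that it is a fixed random
      -- variable to which the induction hypothesis applies.
      have : ∀ ω, A.version μ (fun i t => z i t ω) i (t + 1) =
          (∑ j, A.net.a i j t • A.version μ (fun i t => z i t ω) j (A.net.tau i j t)) +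
            (A.T i).indicator (fun t' => -(A.eps i (t' + 1) • gradObs μ (z i (t' + 1) ω)
              (A.version μ (fun i t => z i t ω) i t))) t := fun ω => by
        rw [version, AsyncNetwork.iterate]
        rfl
      simp only [this]
      exact (Finset.measurable_sum _ fun j _ =>
        (ih _ (Nat.lt_succ_of_le (A.net.tau_le i j t)) j).const_smul (A.net.a i j t)).add
          (A.measurable_indicator_gradObs μ hz i t (ih t (Nat.lt_succ_self t) i))

theorem measurable_descent (hz : ∀ i t, Measurable (z i (t + 1))) (i : Fin M) (t : ℕ) :
    Measurable fun ω => A.descent μ (fun i t => z i t ω) i t := by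
  have : ∀ ω, A.descent μ (fun i t => z i t ω) i t = (A.T i).indicator (fun t' =>
      -(A.eps i (t' + 1) • gradObs μ (z i (t' + 1) ω)
        (A.version μ (fun i t => z i t ω) i t))) t := fun ω => by
    by_cases ht : t ∈ A.T i
    · simp only [descent, Set.indicator_of_mem ht]
    · simp only [descent, Set.indicator_of_notMem ht]
  simp only [this]
  exact A.measurable_indicator_gradObs μ hz i t (A.measurable_version μ hz t i)

theorem measurable_wStar (hz : ∀ i t, Measurable (z i (t + 1))) (t : ℕ) :
    Measurable fun ω => A.wStar μ (fun i t => z i t ω) t := by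
  simp only [wStar, AsyncNetwork.agreement]
  exact measurable_const.add (Finset.measurable_sum _ fun τ _ => Finset.measurable_sum _ fun j _ =>
    (A.measurable_descent μ hz j τ).const_smul (A.net.limCoeff j (τ + 1)))

end DALVQ

/-! ### The asynchronous G-Lemma -/

theorem mainTheorem2 {Ω : Type*} [MeasurableSpace Ω] (P : Measure Ω) [IsProbabilityMeasure P]
    {M κ d : ℕ} (μ : Measure (Pt d)) [IsProbabilityMeasure μ] (hμ : CompactSupportedDensity μ)
    (A : DALVQ M κ d) (hA : A.net.AsY₁ ∨ A.net.AsY₂)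
    -- the observations `z i t`, `t ≥ 1`, are independent with law `μ`
    (z : Fin M → ℕ → Ω → Pt d)
    (hz_meas : ∀ i t, Measurable (z i (t + 1)))
    (hz_law : ∀ i t, P.map (z i (t + 1)) = μ)
    (hz_indep : iIndepFun (fun p : Fin M × ℕ => z p.1 (p.2 + 1)) P)
    -- 1. steps
    (h_sum : Tendsto (fun n => ∑ t ∈ Finset.range n, A.epsStar t) atTop atTop)
    (h_zero : Tendsto A.epsStar atTop (𝓝 0))
    -- 2. boundedness
    (h_bdd : ∀ᵐ ω ∂P, ∃ C : ℝ, ∀ t, ‖A.wStar μ (fun i t => z i t ω) t‖ ≤ C)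
    (h_bdd' : ∀ᵐ ω ∂P, ∃ C : ℝ, ∀ t, ‖avgGrad μ (A.wStar μ (fun i t => z i t ω) t)‖ ≤ C)
    -- 3. convergence of the two series
    (h_M₁ : ∀ᵐ ω ∂P, ∃ S, Tendsto
      (fun n => ∑ t ∈ Finset.range n, A.deltaM₁ μ (fun i t => z i t ω) t) atTop (𝓝 S))
    (h_M₂ : ∀ᵐ ω ∂P, ∃ S, Tendsto
      (fun n => ∑ t ∈ Finset.range n, A.deltaM₂ μ (fun i t => z i t ω) t) atTop (𝓝 S))
    -- 4. the function `G`
    (G : Quantizer κ d → ℝ) (hG_lsc : LowerSemicontinuous G) (hG_nonneg : ∀ x, 0 ≤ G x)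
    (hG_sum : ∀ᵐ ω ∂P, Summable
      (fun t => A.epsStar t * G (A.wStar μ (fun i t => z i t ω) t))) :
    -- the random component is the one containing a random point `ξ` of `{G = 0}`
    ∃ ξ : Ω → Quantizer κ d, Measurable ξ ∧ ∀ᵐ ω ∂P, ξ ω ∈ {x | G x = 0} ∧
      Tendsto (fun t => Metric.infDist (A.wStar μ (fun i t => z i t ω) t)
        (connectedComponentIn {x | G x = 0} (ξ ω))) atTop (𝓝 0) := by
  obtain ⟨ξ, hξ, hcl⟩ := exists_measurable_mapClusterPt (P := P) (A.measurable_wStar μ hz_meas)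
    (h_bdd.mono fun ω ⟨C, hC⟩ => isBounded_iff_forall_norm_le.2
      ⟨C, Set.forall_mem_range.2 hC⟩)
  refine ⟨ξ, hξ, ?_⟩
  filter_upwards [hcl, h_bdd, h_bdd', h_M₁, h_M₂, hG_sum] with ω hx ⟨C, hC⟩ ⟨C', hC'⟩ ⟨S₁, hS₁⟩
    ⟨S₂, hS₂⟩ hGs
  have hS := (hS₁.add hS₂).congr fun n => Finset.sum_add_distrib.symm
  exact ⟨eq_zero_of_mapClusterPt_of_summable A.epsStar_nonneg h_sum (A.wStar_succ μ _) hC' hS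
      hG_lsc hG_nonneg hGs hx,
    tendsto_infDist_connectedComponentIn A.epsStar_nonneg h_sum h_zero
      (isBounded_iff_forall_norm_le.2 ⟨C, Set.forall_mem_range.2 hC⟩) (A.wStar_succ μ _) hC' hS
      hG_lsc hG_nonneg hGs hx⟩
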